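/- Let $R=k[x_1,\dots,x_n]$ be a polynomial ring over a field $k$, let $I\subseteq R$ be a monomial ideal, and let $G(I)$ be its minimal set of monomial generators. The \emph{lcm-lattice} of $I$ is the (finite) set of all least common multiples of subsets of $G(I)$. For $m$ in the lcm-lattice consider two finite simplicial complexes: \[\Gamma_m=\{\tau:\ \tau \text{ a squarefree monomial},\ \tau\mid m,\ m/\tau\in I\},\qquad L_{<m}=\{S\subseteq G(I):\ \operatorname{lcm}(S)\mid m,\ \operatorname{lcm}(S)\neq m\},\] where a squarefree monomial is identified with the set of variables dividing it. For a monomial $u$ let $\sqrt u$ be the set of variables dividing $u$ (equivalently, the largest squarefree monomial dividing $u$). For every $m$ in the lcm-lattice such that $\Gamma_m$ is disconnected, number its connected components $C_{1,m},\dots,C_{k_m,m}$ in any way and choose, for each $i$, an element $\gamma_{i,m}\in G(I)$ dividing $m$ such that $\sqrt{m/\gamma_{i,m}}$ is a facet of $\Gamma_m$ lying in $C_{i,m}$. Similarly, for every $m$ such that $L_{<m}$ is disconnected, number its connected components $C'_{1,m},\dots,C'_{k'_m,m}$ in any way and choose a vertex $\gamma'_{i,m}\in G(I)$ of each $C'_{i,m}$.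 Put \[Z=\bigcup_m\Big\{\tfrac{m}{\gamma_{i,m}}\otimes\gamma_{i,m}-\tfrac{m}{\gamma_{1,m}}\otimes\gamma_{1,m}:\ 2\le i\le k_m\Big\},\qquad Z_L=\bigcup_m\Big\{\tfrac{m}{\gamma'_{i,m}}\otimes\gamma'_{i,m}-\tfrac{m}{\gamma'_{1,m}}\otimes\gamma'_{1,m}:\ 2\le i\le k'_m\Big\},\] subsets of $R\otimes_kR$, the unions being over the $m$ in the lcm-lattice for which $\Gamma_m$, respectively $L_{<m}$, is disconnected. Regard $R\otimes_k R$ as an $R$-module through the left factor. The first syzygies of $I$ form the kernel of the multiplication map $a\otimes b\mapsto ab$ on the free $R$-submodule of $R\otimes_kR$ with basis $\{1\otimes\gamma:\gamma\in G(I)\}$. Then $Z$ and $Z_L$ are minimal generating sets of the $R$-module of first syzygies of $I$: each generates it, and no proper subset of either does. Moreover, each has exactly $b_2(R/I)$ elements, where $b_2(R/I)$ is the minimal number of generators of the module of first syzygies of $I$, and \[b_2(R/I)=\sum_m\dim_k\tilde H_0(\Gamma_m;k)=\sum_m\dim_k\tilde H_0(L_{<m};k),\] the sums being over all $m$ in the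 lcm-lattice. -/

import Mathlib

open MvPolynomial TensorProduct

noncomputable section

namespace MonomialSyzygy

/-! ### Simplicial complexes: components and reduced zeroth homology

`PreAbstractSimplicialComplex ι` is a downward closed collection of nonempty finite subsets of `ι`;
not every element of `ι` has to be a vertex. As usual in Mathlib the empty face is left out. -/

section Complexes

variable {ι : Type*}

/-- The vertices of a simplicial complex. -/
abbrev Vertex (K : PreAbstractSimplicialComplex ι) : Type _ :=
  {v : ι // ({v} : Finset ι) ∈ K.faces}

/-- The graph (1-skeleton) of a simplicial complex. As faces are closed under passing to nonempty
subsets, two distinct vertices lie in a common face iff they form an edge. -/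
def skeleton (K : PreAbstractSimplicialComplex ι) : SimpleGraph (Vertex K) where
  Adj v w := v ≠ w ∧ ∃ s ∈ K.faces, v.1 ∈ s ∧ w.1 ∈ s
  symm := ⟨fun _ _ h => ⟨h.1.symm, h.2.imp fun _ hs => ⟨hs.1, hs.2.2, hs.2.1⟩⟩⟩
  loopless := ⟨fun _ h => h.1 rfl⟩

/-- The connected components of a simplicial complex. -/
abbrev Component (K : PreAbstractSimplicialComplex ι) : Type _ :=
  (skeleton K).ConnectedComponent

/-- The number of connected components (all complexes below have finitely many vertices). -/
def numComponents (K : PreAbstractSimplicialComplex ι) : ℕ := Nat.card (Component K)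

/-- The finite set `s` (a face of `K`) lies in the connected component `C`. -/
def LiesIn (K : PreAbstractSimplicialComplex ι) (s : Finset ι) (C : Component K) : Prop :=
  ∀ v : Vertex K, v.1 ∈ s → (skeleton K).connectedComponentMk v = C

/-- `s` is a facet (a maximal face) of `K`. -/
def IsFacet (K : PreAbstractSimplicialComplex ι) (s : Finset ι) : Prop :=
  Maximal (fun t => t ∈ K.faces) s

/-- The reduced 0-cycles: 0-chains whose coefficients add up to zero. -/
def reducedCycles (k : Type*) [Field k] (K : PreAbstractSimplicialComplex ι) :
    Submodule k (Vertex K →₀ k) :=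
  LinearMap.ker (Finsupp.linearCombination k (fun _ : Vertex K => (1 : k)))

/-- The 0-boundaries: the span of the differences of the end points of edges. -/
def boundaries (k : Type*) [Field k] (K : PreAbstractSimplicialComplex ι) :
    Submodule k (Vertex K →₀ k) :=
  Submodule.span k {c | ∃ v w : Vertex K, (skeleton K).Adj v w ∧
    c = Finsupp.single v 1 - Finsupp.single w 1}

/-- The dimension over `k` of the reduced homology `H̃₀(K; k)`, the reduced 0-cycles modulo the
0-boundaries, as a subspace of all 0-chains modulo the 0-boundaries. -/
def dimReducedH0 (k : Type*) [Field k] (K : PreAbstractSimplicialComplex ι) : ℕ :=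
  Module.finrank k ((reducedCycles k K).map (boundaries k K).mkQ)

end Complexes

/-! ### Monomial ideals

A monomial of `k[x₁, …, xₙ]` is given by its exponent vector `a : Fin n →₀ ℕ`. Then divisibility is
`≤`, the least common multiple is the supremum, the quotient is the difference of exponents, and the
support of a monomial is the finite set of the variables that divide it. -/

section MonomialIdeals

variable {k : Type*} [Field k] {n : ℕ}

/-- `I` is generated by monomials. -/
def IsMonomialIdeal (I : Ideal (MvPolynomial (Fin n) k)) : Prop :=
  ∃ A : Set (Fin n →₀ ℕ), I = Ideal.span ((fun a => monomial a (1 : k)) '' A)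

/-- `G(I)`, the minimal monomial generators of a monomial ideal: the monomials in `I` that are
minimal with respect to divisibility. -/
def minGens (I : Ideal (MvPolynomial (Fin n) k)) : Set (Fin n →₀ ℕ) :=
  {a | Minimal (fun b : Fin n →₀ ℕ => monomial b (1 : k) ∈ I) a}

/-- The lcm-lattice: all least common multiples of (finite) subsets of `G(I)`. -/
def lcmLattice (I : Ideal (MvPolynomial (Fin n) k)) : Set (Fin n →₀ ℕ) :=
  {m | ∃ S : Finset (Fin n →₀ ℕ), (S : Set (Fin n →₀ ℕ)) ⊆ minGens I ∧ S.sup id = m}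

theorem minGens_finite (I : Ideal (MvPolynomial (Fin n) k)) : (minGens I).Finite := by
  have hanti : IsAntichain (· ≤ ·) (minGens I) := by
    intro a ha b hb hab hle
    exact hab (le_antisymm hle (hb.2 ha.1 hle))
  exact WellQuasiOrderedLE.finite_of_isAntichain hanti

theorem lcmLattice_finite (I : Ideal (MvPolynomial (Fin n) k)) : (lcmLattice I).Finite := by
  have h : {S : Finset (Fin n →₀ ℕ) | (S : Set (Fin n →₀ ℕ)) ⊆ minGens I}.Finite :=
    (minGens_finite I).finite_subsets.preimage Finset.coe_injective.injOn
  exact h.image (fun S => S.sup id)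

/-- The exponent vector of the square free monomial `∏_{i ∈ τ} x_i`. -/
def sqFree (τ : Finset (Fin n)) : Fin n →₀ ℕ := ∑ i ∈ τ, Finsupp.single i 1

theorem sqFree_mono {σ τ : Finset (Fin n)} (h : σ ⊆ τ) : sqFree σ ≤ sqFree τ :=
  Finset.sum_le_sum_of_subset h

/-- `Γ_m`: the square free monomials `τ` with `τ ∣ m` and `m / τ ∈ I`. -/
def Gamma (I : Ideal (MvPolynomial (Fin n) k)) (m : Fin n →₀ ℕ) :
    PreAbstractSimplicialComplex (Fin n) where
  faces := {τ | τ.Nonempty ∧ sqFree τ ≤ m ∧ monomial (m - sqFree τ) (1 : k) ∈ I}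
  isRelLowerSet_faces := by
    rintro τ ⟨hne, hle, hmem⟩
    refine ⟨hne, fun σ hσ hσne => ⟨hσne, (sqFree_mono hσ).trans hle, ?_⟩⟩
    have h : m - sqFree σ = (m - sqFree σ - (m - sqFree τ)) + (m - sqFree τ) :=
      (tsub_add_cancel_of_le (tsub_le_tsub_left (sqFree_mono hσ) m)).symm
    have h2 : monomial (m - sqFree σ) (1 : k) =
        monomial (m - sqFree σ - (m - sqFree τ)) (1 : k) * monomial (m - sqFree τ) (1 : k) := by
      rw [monomial_mul, ← h, one_mul]
    rw [h2]
    exact I.mul_mem_left _ hmem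

/-- `L_{<m}`: the subsets `S` of `G(I)` whose least common multiple divides `m` but is not `m`. -/
def LComplex (I : Ideal (MvPolynomial (Fin n) k)) (m : Fin n →₀ ℕ) :
    PreAbstractSimplicialComplex (Fin n →₀ ℕ) where
  faces := {S | S.Nonempty ∧ (S : Set (Fin n →₀ ℕ)) ⊆ minGens I ∧ S.sup id ≤ m ∧ S.sup id ≠ m}
  isRelLowerSet_faces := by
    rintro S ⟨hne, hS, hle, hmem⟩
    refine ⟨hne, fun T hT hTne => ⟨hTne, fun a ha => hS (hT ha),
      (Finset.sup_mono hT).trans hle, fun h => hmem ?_⟩⟩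
    exact le_antisymm hle (h ▸ Finset.sup_mono hT)

/-- `γ 1, …, γ k_m` are admissible representatives of the components `C 1, …, C k_m` of `Γ_m` (in
some numbering): `γ i ∈ G(I)` divides `m`, and the support of `m / γ i` is a facet of `Γ_m` that
lies in `C i`. -/
def IsGammaChoice (I : Ideal (MvPolynomial (Fin n) k)) (m : Fin n →₀ ℕ)
    (γ : ℕ → (Fin n →₀ ℕ)) : Prop :=
  ∃ C : ℕ → Component (Gamma I m),
    Set.BijOn C (Set.Icc 1 (numComponents (Gamma I m))) Set.univ ∧
    ∀ i ∈ Set.Icc 1 (numComponents (Gamma I m)),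
      γ i ∈ minGens I ∧ γ i ≤ m ∧
      IsFacet (Gamma I m) (m - γ i).support ∧ LiesIn (Gamma I m) (m - γ i).support (C i)

/-- `γ 1, …, γ k_m` are vertices of the components `C 1, …, C k_m` of `L_{<m}` (in some
numbering). -/
def IsLChoice (I : Ideal (MvPolynomial (Fin n) k)) (m : Fin n →₀ ℕ)
    (γ : ℕ → (Fin n →₀ ℕ)) : Prop :=
  ∃ C : ℕ → Component (LComplex I m),
    Set.BijOn C (Set.Icc 1 (numComponents (LComplex I m))) Set.univ ∧
    ∀ i ∈ Set.Icc 1 (numComponents (LComplex I m)),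
      ∃ v : Vertex (LComplex I m), v.1 = γ i ∧ (skeleton (LComplex I m)).connectedComponentMk v = C i

/-! ### First syzygies -/

variable (k) in
/-- The element `(m / γ) ⊗ γ - (m / γ') ⊗ γ'` of `R ⊗ R`. -/
def syzElt (m γ γ' : Fin n →₀ ℕ) : MvPolynomial (Fin n) k ⊗[k] MvPolynomial (Fin n) k :=
  monomial (m - γ) (1 : k) ⊗ₜ[k] monomial γ (1 : k) -
    monomial (m - γ') (1 : k) ⊗ₜ[k] monomial γ' (1 : k)

/-- The module of first syzygies of `I`, as an `R`-submodule of `R ⊗ R` (with `R` acting on the left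
factor). The elements `1 ⊗ γ`, `γ ∈ G(I)`, are linearly independent over `R`; on the free module
that they span the multiplication is the map onto `I` which sends the basis element of `γ` to `γ`,
and the first syzygies are its kernel. -/
def firstSyzygies (I : Ideal (MvPolynomial (Fin n) k)) :
    Submodule (MvPolynomial (Fin n) k) (MvPolynomial (Fin n) k ⊗[k] MvPolynomial (Fin n) k) :=
  Submodule.span (MvPolynomial (Fin n) k)
      ((fun γ => (1 : MvPolynomial (Fin n) k) ⊗ₜ[k] monomial γ (1 : k)) '' minGens I) ⊓
    LinearMap.ker (Algebra.TensorProduct.lmul'' k (S := MvPolynomial (Fin n) k)).toLinearMap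

/-- `b₂(R/I)`: the minimal number of generators of the module of first syzygies of `I`. -/
def bettiTwo (I : Ideal (MvPolynomial (Fin n) k)) : ℕ := (firstSyzygies I).spanFinrank

/-- A generating set none of whose proper subsets generates. -/
def IsMinimalGeneratingSet {R M : Type*} [Ring R] [AddCommGroup M] [Module R M]
    (N : Submodule R M) (Z : Set M) : Prop :=
  Submodule.span R Z = N ∧ ∀ W, W ⊂ Z → Submodule.span R W ≠ N

/-- `Z = ⋃ₘ { (m/γ_{i,m}) ⊗ γ_{i,m} - (m/γ_{1,m}) ⊗ γ_{1,m} : 2 ≤ i ≤ k_m }`, for the complexes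
`Γ_m`. -/
def ZGamma (I : Ideal (MvPolynomial (Fin n) k)) (γ : (Fin n →₀ ℕ) → ℕ → (Fin n →₀ ℕ)) :
    Set (MvPolynomial (Fin n) k ⊗[k] MvPolynomial (Fin n) k) :=
  ⋃ m ∈ lcmLattice I, {z | ∃ i, 2 ≤ i ∧ i ≤ numComponents (Gamma I m) ∧
    z = syzElt k m (γ m i) (γ m 1)}

/-- The analogous set for the complexes `L_{<m}`. -/
def ZL (I : Ideal (MvPolynomial (Fin n) k)) (γ : (Fin n →₀ ℕ) → ℕ → (Fin n →₀ ℕ)) :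
    Set (MvPolynomial (Fin n) k ⊗[k] MvPolynomial (Fin n) k) :=
  ⋃ m ∈ lcmLattice I, {z | ∃ i, 2 ≤ i ∧ i ≤ numComponents (LComplex I m) ∧
    z = syzElt k m (γ m i) (γ m 1)}

end MonomialIdeals

end MonomialSyzygy

end

/-! Match a generator `γ`, as a vertex of `L_{<m}`, with every variable dividing `m / γ`. Two
generators dividing `m` have a common variable exactly when their lcm is a proper divisor of `m`, so
the matching identifies the components of `L_{<m}` with those of `Γ_m`
(`exists_equiv_component_Gamma`). An admissible choice for `Γ_m` is thus one for `L_{<m}`, and only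
`Z_L` has to be treated.

Generation: the syzygies are spanned by differences `(m/a) ⊗ a - (m/b) ⊗ b` (`firstSyzygies_le`). If
`lcm(a, b) ≠ m`, such a difference is a monomial multiple of one in a lower degree. Differences
telescope along paths, so by induction on `m` only one difference per extra component is new
(`syzElt_mem_span_ZL`).

Minimality: add up the degree `m` coefficients over the generators in one component of `L_{<m}`. On
syzygies, `R` acts on this functional through the constant term (`weightedCoeff_smul`), and the
functionals for the components with index at least 2 are dual to `Z_L`. Hence any generating set has
image spanning `k^P`, where `P` indexes `Z_L`, and has at least `|P|` elements
(`isMinimalGeneratingSet_range`). Finally `dim H̃₀` is the number of components minus one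
(`dimReducedH0_eq`). -/

noncomputable section

namespace MonomialSyzygy

/-! ### Reduced zeroth homology and components of a complex -/

section Complexes

variable {ι : Type*}

/-- Collapsing the vertices of a complex to its components has the boundaries as its kernel. -/
theorem ker_lmapDomain_connectedComponentMk (k : Type*) [Field k]
    (K : PreAbstractSimplicialComplex ι) :
    LinearMap.ker (Finsupp.lmapDomain k k (skeleton K).connectedComponentMk) = boundaries k K := by
  have hreach : ∀ v w : Vertex K, (skeleton K).Reachable v w →
      (Finsupp.single v 1 - Finsupp.single w 1 : Vertex K →₀ k) ∈ boundaries k K := by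
    rintro v w ⟨p⟩
    induction p with
    | nil => simp
    | @cons u v w h p ih =>
      have := add_mem (Submodule.subset_span (s := {c | ∃ v w : Vertex K, (skeleton K).Adj v w ∧
        c = Finsupp.single v (1 : k) - Finsupp.single w 1}) ⟨u, v, h, rfl⟩) ih
      simpa [boundaries] using this
  apply le_antisymm
  · intro c hc
    -- Moving every vertex to the representative of its component changes a chain only by a
    -- boundary, and the moved chain depends only on the image of `c` in the chains on components.
    set out : Component K → Vertex K := fun C => C.out with hout
    have key : ∀ c : Vertex K →₀ k,
        c - Finsupp.mapDomain (fun v => out ((skeleton K).connectedComponentMk v)) c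
          ∈ boundaries k K := by
      intro c
      induction c using Finsupp.induction_linear with
      | zero => simp
      | add f g hf hg =>
        rw [Finsupp.mapDomain_add, add_sub_add_comm]
        exact add_mem hf hg
      | single v a =>
        have h1 : (skeleton K).Reachable v (out ((skeleton K).connectedComponentMk v)) := by
          apply SimpleGraph.ConnectedComponent.exact
          exact (Quot.out_eq _).symm
        have := Submodule.smul_mem _ a (hreach _ _ h1)
        simpa [smul_sub, Finsupp.mapDomain_single] using this
    have h2 : Finsupp.mapDomain (fun v => out ((skeleton K).connectedComponentMk v)) c = 0 := by
      have h3 : Finsupp.mapDomain (skeleton K).connectedComponentMk c = 0 := hc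
      have := Finsupp.mapDomain_comp (f := (skeleton K).connectedComponentMk) (g := out) (v := c)
      rw [h3, Finsupp.mapDomain_zero] at this
      exact this
    simpa [h2] using key c
  · rw [boundaries, Submodule.span_le]
    rintro c ⟨v, w, h, rfl⟩
    have : (skeleton K).connectedComponentMk v = (skeleton K).connectedComponentMk w :=
      SimpleGraph.ConnectedComponent.sound h.reachable
    rw [SetLike.mem_coe, LinearMap.mem_ker, map_sub, Finsupp.lmapDomain_apply,
      Finsupp.lmapDomain_apply, Finsupp.mapDomain_single, Finsupp.mapDomain_single, this, sub_self]

/-- Modulo boundaries, chains become functions on the components and cycles the kernel of the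
coefficient sum. That sum is onto `k` unless there is no component, where the truncated subtraction
also gives 0. -/
theorem dimReducedH0_eq (k : Type*) [Field k] (K : PreAbstractSimplicialComplex ι)
    [Finite (Vertex K)] : dimReducedH0 k K = numComponents K - 1 := by
  classical
  set π := Finsupp.lmapDomain k k (skeleton K).connectedComponentMk with hπ
  have hsurj : Function.Surjective π :=
    Finsupp.mapDomain_surjective (fun C => Quot.exists_rep C)
  have : Finite (Component K) := Quot.finite _
  have : Fintype (Component K) := Fintype.ofFinite _
  set σ : (Component K →₀ k) →ₗ[k] k :=
    Finsupp.linearCombination k (fun _ : Component K => (1 : k)) with hσ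
  have hcomp : reducedCycles k K = (LinearMap.ker σ).comap π := by
    rw [reducedCycles, ← LinearMap.ker_comp]
    congr 1
    ext v
    simp [hσ, hπ]
  have h1 : dimReducedH0 k K = Module.finrank k (LinearMap.ker σ) := by
    let e := (Submodule.quotEquivOfEq _ _
      (ker_lmapDomain_connectedComponentMk k K).symm).trans (π.quotKerEquivOfSurjective hsurj)
    rw [dimReducedH0, ← LinearEquiv.finrank_map_eq e]
    have he : (e : _ →ₗ[k] _) ∘ₗ (boundaries k K).mkQ = π := by
      ext v
      simp [e]
    rw [← Submodule.map_comp, he, hcomp, Submodule.map_comap_eq_of_surjective hsurj]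
  have h2 := LinearMap.finrank_range_add_finrank_ker σ
  have h3 : Module.finrank k (Component K →₀ k) = numComponents K := by
    rw [Module.finrank_finsupp_self, numComponents, Nat.card_eq_fintype_card]
  rw [h3] at h2
  rw [h1]
  rcases isEmpty_or_nonempty (Component K) with he | ⟨⟨C⟩⟩
  · have : numComponents K = 0 := by simp [numComponents]
    omega
  · have : LinearMap.range σ = ⊤ := by
      rw [LinearMap.range_eq_top]
      intro a
      exact ⟨Finsupp.single C a, by simp [hσ]⟩
    rw [this, finrank_top, Module.finrank_self] at h2
    omega

/-- A correspondence between the vertices of two graphs that matches adjacency with having a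
common partner induces a bijection of the connected components. -/
theorem exists_componentEquiv {V W : Type*} (G : SimpleGraph V) (H : SimpleGraph W)
    (r : V → W → Prop) (hl : ∀ v, ∃ w, r v w) (hr : ∀ w, ∃ v, r v w)
    (hV : ∀ v v' w, r v w → r v' w → G.Reachable v v')
    (hW : ∀ v w w', r v w → r v w' → H.Reachable w w')
    (hG : ∀ v v', G.Adj v v' → ∃ w, r v w ∧ r v' w)
    (hH : ∀ w w', H.Adj w w' → ∃ v, r v w ∧ r v w') :
    ∃ e : G.ConnectedComponent ≃ H.ConnectedComponent,
      ∀ v w, r v w → e (G.connectedComponentMk v) = H.connectedComponentMk w := by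
  have hGr : ∀ v v' w w', G.Reachable v v' → r v w → r v' w' → H.Reachable w w' := by
    rintro v v' w w' ⟨p⟩ hvw hvw'
    induction p generalizing w with
    | nil => exact hW _ _ _ hvw hvw'
    | cons h p ih =>
      obtain ⟨x, hx, hx'⟩ := hG _ _ h
      exact (hW _ _ _ hvw hx).trans (ih x hx' hvw')
  have hHr : ∀ w w' v v', H.Reachable w w' → r v w → r v' w' → G.Reachable v v' := by
    rintro w w' v v' ⟨p⟩ hvw hvw'
    induction p generalizing v with
    | nil => exact hV _ _ _ hvw hvw'
    | cons h p ih =>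
      obtain ⟨x, hx, hx'⟩ := hH _ _ h
      exact (hV _ _ _ hvw hx).trans (ih x hx' hvw')
  choose f hf using hl
  let φ : G.ConnectedComponent → H.ConnectedComponent :=
    Quot.lift (fun v => H.connectedComponentMk (f v)) fun v v' h =>
      SimpleGraph.ConnectedComponent.sound (hGr _ _ _ _ h (hf v) (hf v'))
  have hφ : ∀ v w, r v w → φ (G.connectedComponentMk v) = H.connectedComponentMk w :=
    fun v w h => SimpleGraph.ConnectedComponent.sound (hW _ _ _ (hf v) h)
  refine ⟨Equiv.ofBijective φ ⟨?_, ?_⟩, hφ⟩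
  · rintro ⟨v⟩ ⟨v'⟩ h
    exact SimpleGraph.ConnectedComponent.sound
      (hHr _ _ _ _ (SimpleGraph.ConnectedComponent.exact h) (hf v) (hf v'))
  · rintro ⟨w⟩
    obtain ⟨v, hv⟩ := hr w
    exact ⟨G.connectedComponentMk v, hφ v w hv⟩

theorem reachable_of_mem_face (K : PreAbstractSimplicialComplex ι) {s : Finset ι}
    (hs : s ∈ K.faces) (v w : Vertex K) (hv : v.1 ∈ s) (hw : w.1 ∈ s) :
    (skeleton K).Reachable v w := by
  by_cases h : v = w
  · rw [h]
  · exact SimpleGraph.Adj.reachable ⟨h, s, hs, hv, hw⟩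

end Complexes

/-! ### Comparison of `Γ_m` with `L_{<m}` -/

section Comparison

variable {k : Type*} [Field k] {n : ℕ} {I : Ideal (MvPolynomial (Fin n) k)} {m : Fin n →₀ ℕ}

theorem sqFree_apply (τ : Finset (Fin n)) (i : Fin n) : sqFree τ i = if i ∈ τ then 1 else 0 := by
  simp [sqFree, Finsupp.finsetSum_apply, Finsupp.single_apply]

theorem monomial_mem_iff_exists_minGens {a : Fin n →₀ ℕ} :
    monomial a (1 : k) ∈ I ↔ ∃ γ ∈ minGens I, γ ≤ a := by
  constructor
  · intro h
    obtain ⟨γ, hle, hγ⟩ := exists_minimal_le_of_wellFoundedLT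
      (fun b : Fin n →₀ ℕ => monomial b (1 : k) ∈ I) a h
    exact ⟨γ, hγ, hle⟩
  · rintro ⟨γ, hγ, hle⟩
    have : monomial a (1 : k) = monomial (a - γ) 1 * monomial γ 1 := by
      rw [monomial_mul, tsub_add_cancel_of_le hle, one_mul]
    rw [this]
    exact I.mul_mem_left _ hγ.1

/-- The faces of `Γ_m` are the nonempty subsets of the supports of the `m / γ`. -/
theorem mem_Gamma_faces {τ : Finset (Fin n)} : τ ∈ (Gamma I m).faces ↔
    τ.Nonempty ∧ ∃ γ ∈ minGens I, γ ≤ m ∧ τ ⊆ (m - γ).support := by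
  have key : ∀ γ : Fin n →₀ ℕ,
      (sqFree τ ≤ m ∧ γ ≤ m - sqFree τ) ↔ (γ ≤ m ∧ τ ⊆ (m - γ).support) := by
    intro γ
    simp only [Finsupp.le_def, Finset.subset_iff, Finsupp.mem_support_iff, Finsupp.tsub_apply,
      sqFree_apply]
    constructor
    · rintro ⟨h1, h2⟩
      refine ⟨fun i => (h2 i).trans (Nat.sub_le _ _), fun i hi => ?_⟩
      have := h1 i
      have := h2 i
      simp only [hi, if_true] at *
      omega
    · rintro ⟨h1, h2⟩
      refine ⟨fun i => ?_, fun i => ?_⟩ <;>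
      · have := h1 i
        split_ifs with hi
        · have := h2 hi
          omega
        · omega
  change _ ∧ _ ∧ _ ↔ _
  rw [monomial_mem_iff_exists_minGens]
  refine and_congr_right fun _ => ⟨?_, ?_⟩
  · rintro ⟨h, γ, hγ, h'⟩
    exact ⟨γ, hγ, (key γ).1 ⟨h, h'⟩⟩
  · rintro ⟨γ, hγ, h⟩
    obtain ⟨h1, h2⟩ := (key γ).2 h
    exact ⟨h1, γ, hγ, h2⟩

theorem singleton_mem_LComplex {a : Fin n →₀ ℕ} :
    {a} ∈ (LComplex I m).faces ↔ a ∈ minGens I ∧ a ≤ m ∧ a ≠ m := by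
  change _ ∧ _ ∧ _ ↔ _
  simp

theorem pair_mem_LComplex {a b : Fin n →₀ ℕ} (ha : a ∈ minGens I) (hb : b ∈ minGens I)
    (h : a ⊔ b < m) : {a, b} ∈ (LComplex I m).faces := by
  refine ⟨by simp, ?_, ?_, ?_⟩
  · simp [Set.insert_subset_iff, ha, hb]
  · simpa using h.le
  · simpa using h.ne

theorem sup_lt_of_mem_face {a b : Fin n →₀ ℕ} {S : Finset (Fin n →₀ ℕ)}
    (hS : S ∈ (LComplex I m).faces) (ha : a ∈ S) (hb : b ∈ S) : a ⊔ b < m :=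
  (sup_le (Finset.le_sup (f := id) ha) (Finset.le_sup (f := id) hb)).trans_lt
    (lt_of_le_of_ne hS.2.2.1 hS.2.2.2)

theorem support_tsub_nonempty {a b : Fin n →₀ ℕ} (h : a < b) : (b - a).support.Nonempty := by
  rw [Finsupp.support_nonempty_iff]
  intro h0
  exact h.not_ge (tsub_eq_zero_iff_le.1 h0)

theorem mem_support_tsub {a : Fin n →₀ ℕ} {i : Fin n} : i ∈ (m - a).support ↔ a i < m i := by
  simp [Nat.sub_eq_zero_iff_le]

variable (I m) in
/-- The components of `L_{<m}` correspond to those of `Γ_m`. -/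
theorem exists_equiv_component_Gamma :
    ∃ e : Component (LComplex I m) ≃ Component (Gamma I m),
      ∀ (v : Vertex (LComplex I m)) (i : Vertex (Gamma I m)), i.1 ∈ (m - v.1).support →
        e ((skeleton _).connectedComponentMk v) = (skeleton _).connectedComponentMk i := by
  have hv : ∀ v : Vertex (LComplex I m), v.1 ∈ minGens I ∧ v.1 ≤ m ∧ v.1 ≠ m :=
    fun v => singleton_mem_LComplex.1 v.2
  have hmem : ∀ (v : Vertex (LComplex I m)) (i : Fin n), i ∈ (m - v.1).support →
      {i} ∈ (Gamma I m).faces := fun v i hi =>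
    mem_Gamma_faces.2 ⟨by simp, v.1, (hv v).1, (hv v).2.1, by simpa using hi⟩
  apply exists_componentEquiv
  · intro v
    obtain ⟨i, hi⟩ := support_tsub_nonempty (lt_of_le_of_ne (hv v).2.1 (hv v).2.2)
    exact ⟨⟨i, hmem v i hi⟩, hi⟩
  · rintro ⟨i, hi⟩
    obtain ⟨-, γ, hγ, hle, hs⟩ := mem_Gamma_faces.1 hi
    have hs' : i ∈ (m - γ).support := hs (by simp)
    refine ⟨⟨γ, singleton_mem_LComplex.2 ⟨hγ, hle, ?_⟩⟩, hs'⟩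
    rintro rfl
    simp at hs'
  · intro v v' i h h'
    refine reachable_of_mem_face _ (pair_mem_LComplex (hv v).1 (hv v').1 ?_) v v'
      (by simp) (by simp)
    -- At the common variable both exponents are below that of `m`, so the lcm is not `m`.
    refine lt_of_le_of_ne (sup_le (hv v).2.1 (hv v').2.1) fun heq => ?_
    have h1 := DFunLike.congr_fun heq i.1
    rw [mem_support_tsub] at h h'
    rw [Finsupp.sup_apply] at h1
    exact (max_lt h h').ne h1
  · intro v i j hi hj
    exact reachable_of_mem_face _ (mem_Gamma_faces.2
      ⟨⟨_, hi⟩, v.1, (hv v).1, (hv v).2.1, subset_rfl⟩) i j hi hj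
  · rintro v v' ⟨-, S, hS, h, h'⟩
    -- A variable dividing `m / lcm` divides both quotients and so is a common partner.
    obtain ⟨i, hi⟩ := support_tsub_nonempty (sup_lt_of_mem_face hS h h')
    rw [mem_support_tsub, Finsupp.sup_apply, max_lt_iff] at hi
    have h1 := mem_support_tsub.2 hi.1
    exact ⟨⟨i, hmem v i h1⟩, h1, mem_support_tsub.2 hi.2⟩
  · rintro i j ⟨-, s, hs, hi, hj⟩
    obtain ⟨-, γ, hγ, hle, hsub⟩ := mem_Gamma_faces.1 hs
    refine ⟨⟨γ, singleton_mem_LComplex.2 ⟨hγ, hle, ?_⟩⟩, hsub hi, hsub hj⟩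
    rintro rfl
    simpa using hsub hi

variable (I m) in
theorem numComponents_Gamma : numComponents (Gamma I m) = numComponents (LComplex I m) := by
  obtain ⟨e, -⟩ := exists_equiv_component_Gamma I m
  exact (Nat.card_congr e).symm

/-- A facet is nonempty, so some variable divides `m / γ i`; it is matched with the vertex `γ i`,
and the equivalence of components transports the numbering. -/
theorem IsGammaChoice.isLChoice {γ : ℕ → (Fin n →₀ ℕ)} (h : IsGammaChoice I m γ) :
    IsLChoice I m γ := by
  obtain ⟨e, he⟩ := exists_equiv_component_Gamma I m
  obtain ⟨C, hC, hγ⟩ := h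
  rw [numComponents_Gamma] at hC hγ
  refine ⟨fun i => e.symm (C i), (e.symm.bijective.bijOn_univ).comp hC, fun i hi => ?_⟩
  obtain ⟨hmin, hle, hfacet, hlies⟩ := hγ i hi
  obtain ⟨j, hj⟩ := (mem_Gamma_faces.1 hfacet.1).1
  have hj' : {j} ∈ (Gamma I m).faces :=
    mem_Gamma_faces.2 ⟨by simp, γ i, hmin, hle, by simpa using hj⟩
  have hne : γ i ≠ m := by
    intro h
    simp [h] at hj
  refine ⟨⟨γ i, singleton_mem_LComplex.2 ⟨hmin, hle, hne⟩⟩, rfl, ?_⟩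
  exact e.eq_symm_apply.2 ((he _ ⟨j, hj'⟩ hj).trans (hlies ⟨j, hj'⟩ hj))

instance finite_vertex_LComplex : Finite (Vertex (LComplex I m)) :=
  ((minGens_finite I).subset fun _ h => (singleton_mem_LComplex.1 h).1).to_subtype

end Comparison

/-! ### Lower bounds on generating sets from dual functionals -/

section DualFunctionals

variable {R M k : Type*} [CommRing R] [AddCommGroup M] [Module R M] [Field k] {N : Submodule R M}
  {P : Type*} [Fintype P] [DecidableEq P]

/-- A generating set has at least as many elements as there are functionals with values in a residue
field that are dual to some elements of the module. -/
theorem card_le_encard_of_dual (ε : R →+* k) (Φ : M →+ (P → k))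
    (hΦ : ∀ r, ∀ f ∈ N, Φ (r • f) = ε r • Φ f) (z : P → M)
    (hz : ∀ p, z p ∈ N) (hdual : ∀ p, Φ (z p) = Pi.single p 1)
    {W : Set M} (hW : Submodule.span R W = N) : (Fintype.card P : ℕ∞) ≤ W.encard := by
  have hmem : ∀ f ∈ Submodule.span R W, Φ f ∈ Submodule.span k (Φ '' W) := by
    intro f hf
    induction hf using Submodule.span_induction with
    | mem x h => exact Submodule.subset_span ⟨x, h, rfl⟩
    | zero => simp
    | add x y _ _ hx hy => rw [map_add]; exact add_mem hx hy
    | smul r x hx ih =>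
      rw [hΦ r x (hW ▸ hx)]
      exact Submodule.smul_mem _ _ ih
  have htop : Submodule.span k (Φ '' W) = ⊤ := by
    rw [eq_top_iff, ← (Pi.basisFun k P).span_eq, Submodule.span_le]
    rintro _ ⟨p, rfl⟩
    rw [Pi.basisFun_apply, ← hdual p]
    exact hmem _ (hW ▸ hz p)
  have h1 := Submodule.spanFinrank_span_le_encard (R := k) (Φ '' W)
  rw [htop, ← Module.finrank_eq_spanFinrank_of_free, Module.finrank_fintype_fun_eq_card] at h1
  exact h1.trans (Set.encard_image_le _ _)

/-- A generating family with dual functionals is a minimal generating set, of the least possible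
cardinality. -/
theorem isMinimalGeneratingSet_range (ε : R →+* k) (Φ : M →+ (P → k))
    (hΦ : ∀ r, ∀ f ∈ N, Φ (r • f) = ε r • Φ f) (z : P → M)
    (hspan : Submodule.span R (Set.range z) = N) (hdual : ∀ p, Φ (z p) = Pi.single p 1) :
    IsMinimalGeneratingSet N (Set.range z) ∧ (Set.range z).encard = Fintype.card P ∧
      N.spanFinrank = Fintype.card P := by
  have hz : ∀ p, z p ∈ N := fun p => hspan ▸ Submodule.subset_span ⟨p, rfl⟩
  have hle : ∀ {W : Set M}, Submodule.span R W = N → (Fintype.card P : ℕ∞) ≤ W.encard :=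
    fun hW => card_le_encard_of_dual ε Φ hΦ z hz hdual hW
  have hcard : (Set.range z).encard = Fintype.card P := by
    refine le_antisymm ?_ (hle hspan)
    rw [← Set.image_univ]
    refine (Set.encard_image_le _ _).trans ?_
    simp
  refine ⟨⟨hspan, fun W hW hWN => ?_⟩, hcard, ?_⟩
  · have h1 := ((Set.finite_range z).subset hW.subset).encard_lt_encard hW
    exact (hcard ▸ h1).not_ge (hle hWN)
  · apply le_antisymm
    · have := Submodule.spanFinrank_span_le_encard (R := R) (Set.range z)
      rw [hspan, hcard] at this
      exact_mod_cast this
    · have hfg : N.FG := hspan ▸ Submodule.fg_span (Set.finite_range z)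
      obtain ⟨s, hs, hs'⟩ := hfg.exists_span_set_encard_eq_spanFinrank
      have := hle hs'
      rw [hs] at this
      exact_mod_cast this

end DualFunctionals

/-! ### The syzygy module inside `R ⊗ R` -/

section Syzygies

variable {k : Type*} [Field k] {n : ℕ}

variable (k) in
/-- The coordinate at `1 ⊗ γ` of an element of `R ⊗ R`. -/
def coord (γ : Fin n →₀ ℕ) : (MvPolynomial (Fin n) k ⊗[k] MvPolynomial (Fin n) k)
    →ₗ[MvPolynomial (Fin n) k] MvPolynomial (Fin n) k :=
  (AlgebraTensorModule.rid k (MvPolynomial (Fin n) k) (MvPolynomial (Fin n) k)).toLinearMap ∘ₗ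
    AlgebraTensorModule.lTensor (MvPolynomial (Fin n) k) (MvPolynomial (Fin n) k)
      (lcoeff k γ)

theorem coord_tmul (γ : Fin n →₀ ℕ) (a b : MvPolynomial (Fin n) k) :
    coord k γ (a ⊗ₜ[k] b) = coeff γ b • a := by
  simp [coord]

theorem coord_tmul_monomial (γ γ' : Fin n →₀ ℕ) (a : MvPolynomial (Fin n) k) :
    coord k γ (a ⊗ₜ[k] monomial γ' 1) = if γ' = γ then a else 0 := by
  rw [coord_tmul, coeff_monomial]
  split_ifs <;> simp

variable (k) in
/-- The multiplication map on `R ⊗ R`. -/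
def mulMap (n : ℕ) : (MvPolynomial (Fin n) k ⊗[k] MvPolynomial (Fin n) k)
    →ₗ[MvPolynomial (Fin n) k] MvPolynomial (Fin n) k :=
  (Algebra.TensorProduct.lmul'' k (S := MvPolynomial (Fin n) k)).toLinearMap

theorem mulMap_tmul (a b : MvPolynomial (Fin n) k) : mulMap k n (a ⊗ₜ[k] b) = a * b := by
  change Algebra.TensorProduct.lmul'' k (a ⊗ₜ[k] b) = a * b
  simp [Algebra.TensorProduct.lmul'']

variable (I : Ideal (MvPolynomial (Fin n) k))

/-- The free module on the minimal generators, inside `R ⊗ R`. -/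
def genModule : Submodule (MvPolynomial (Fin n) k)
    (MvPolynomial (Fin n) k ⊗[k] MvPolynomial (Fin n) k) :=
  Submodule.span (MvPolynomial (Fin n) k)
      ((fun γ => (1 : MvPolynomial (Fin n) k) ⊗ₜ[k] monomial γ (1 : k)) '' minGens I)

theorem mem_firstSyzygies {f : MvPolynomial (Fin n) k ⊗[k] MvPolynomial (Fin n) k} :
    f ∈ firstSyzygies I ↔ f ∈ genModule I ∧ mulMap k n f = 0 := Iff.rfl

variable {I}

theorem mulMap_eq_sum {f : MvPolynomial (Fin n) k ⊗[k] MvPolynomial (Fin n) k}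
    (hf : f ∈ genModule I) :
    mulMap k n f = ∑ γ ∈ (minGens_finite I).toFinset, coord k γ f * monomial γ 1 := by
  induction hf using Submodule.span_induction with
  | mem x h =>
    obtain ⟨γ, hγ, rfl⟩ := h
    simp only [mulMap_tmul, coord_tmul_monomial, ite_mul, zero_mul]
    rw [Finset.sum_ite_eq, if_pos (by simpa using hγ)]
  | zero => simp
  | add x y _ _ hx hy => simp only [map_add, hx, hy, add_mul, Finset.sum_add_distrib]
  | smul r x _ ih => simp only [map_smul, ih, smul_eq_mul, mul_assoc, Finset.mul_sum]

theorem tmul_monomial_mem_genModule {γ : Fin n →₀ ℕ} (hγ : γ ∈ minGens I)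
    (a : MvPolynomial (Fin n) k) :
    a ⊗ₜ[k] monomial γ 1 ∈ genModule I := by
  have := (genModule I).smul_mem a (Submodule.subset_span ⟨γ, hγ, rfl⟩)
  simpa [TensorProduct.smul_tmul'] using this

/-- This reduces a difference in degree `m` to one in the degree of the lcm of the two generators.
-/
theorem monomial_smul_syzElt {m m' γ γ' : Fin n →₀ ℕ} (hm : m' ≤ m) (h : γ ≤ m') (h' : γ' ≤ m') :
    monomial (m - m') (1 : k) • syzElt k m' γ γ' = syzElt k m γ γ' := by
  simp only [syzElt, smul_sub, TensorProduct.smul_tmul', smul_eq_mul, monomial_mul, one_mul,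
    tsub_add_tsub_cancel hm h, tsub_add_tsub_cancel hm h']

theorem syzElt_mem_firstSyzygies {m γ γ' : Fin n →₀ ℕ} (hγ : γ ∈ minGens I) (hγ' : γ' ∈ minGens I)
    (h : γ ≤ m) (h' : γ' ≤ m) : syzElt k m γ γ' ∈ firstSyzygies I := by
  rw [mem_firstSyzygies]
  refine ⟨sub_mem (tmul_monomial_mem_genModule hγ _) (tmul_monomial_mem_genModule hγ' _), ?_⟩
  simp only [syzElt, map_sub, mulMap_tmul, monomial_mul, tsub_add_cancel_of_le h,
    tsub_add_cancel_of_le h', sub_self]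

theorem syzElt_self (m γ : Fin n →₀ ℕ) : syzElt k m γ γ = 0 := sub_self _

theorem syzElt_add (m a b c : Fin n →₀ ℕ) :
    syzElt k m a b + syzElt k m b c = syzElt k m a c := by
  simp [syzElt]

theorem neg_syzElt (m a b : Fin n →₀ ℕ) : -syzElt k m a b = syzElt k m b a := by
  simp [syzElt]

/-- The syzygies are generated by the differences of multiples of two generators. -/
theorem firstSyzygies_le {T : Submodule (MvPolynomial (Fin n) k)
    (MvPolynomial (Fin n) k ⊗[k] MvPolynomial (Fin n) k)}
    (hT : ∀ m, ∀ γ ∈ minGens I, ∀ γ' ∈ minGens I, γ ≤ m → γ' ≤ m → syzElt k m γ γ' ∈ T) :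
    firstSyzygies I ≤ T := by
  classical
  let c : (Fin n →₀ ℕ) → (MvPolynomial (Fin n) k ⊗[k] MvPolynomial (Fin n) k) ⧸ T := fun m =>
    if h : ∃ γ ∈ minGens I, γ ≤ m then T.mkQ (monomial (m - h.choose) 1 ⊗ₜ monomial h.choose 1)
    else 0
  have hc : ∀ m, ∀ γ ∈ minGens I, γ ≤ m →
      c m = T.mkQ (monomial (m - γ) 1 ⊗ₜ monomial γ 1) := by
    intro m γ hγ hle
    have h : ∃ γ ∈ minGens I, γ ≤ m := ⟨γ, hγ, hle⟩
    simp only [c, dif_pos h]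
    rw [← sub_eq_zero, ← map_sub]
    exact (Submodule.Quotient.mk_eq_zero T).2
      (hT m _ h.choose_spec.1 _ hγ h.choose_spec.2 hle)
  let Ψ : MvPolynomial (Fin n) k →ₗ[k] _ := (basisMonomials (Fin n) k).constr k c
  have hΨ : ∀ m, Ψ (monomial m 1) = c m := by
    intro m
    have := (basisMonomials (Fin n) k).constr_basis k c m
    rwa [coe_basisMonomials] at this
  -- On the free module the projection modulo `T` factors through multiplication, so it kills
  -- syzygies. The factor `r` is carried along because `Ψ` is only `k`-linear.
  have key : ∀ f ∈ genModule I, ∀ r : MvPolynomial (Fin n) k,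
      T.mkQ (r • f) = Ψ (mulMap k n (r • f)) := by
    intro f hf
    induction hf using Submodule.span_induction with
    | mem x h =>
      obtain ⟨γ, hγ, rfl⟩ := h
      intro r
      simp only [TensorProduct.smul_tmul', smul_eq_mul, mul_one, mulMap_tmul]
      induction r using MvPolynomial.induction_on' with
      | monomial b a =>
        have h1 : monomial b a = a • monomial b (1 : k) := by simp [smul_monomial]
        have h2 := hc (b + γ) γ hγ (by simp)
        rw [add_tsub_cancel_right, ← hΨ] at h2
        rw [h1, smul_mul_assoc, map_smul, monomial_mul, one_mul, h2,
          ← TensorProduct.smul_tmul', ← LinearMap.map_smul_of_tower]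
      | add p q hp hq => rw [TensorProduct.add_tmul, map_add, hp, hq, add_mul, map_add]
    | zero => simp
    | add x y _ _ hx hy => intro r; simp only [smul_add, map_add, hx, hy]
    | smul s x _ ih => intro r; rw [smul_smul]; exact ih _
  intro f hf
  obtain ⟨hf, hf0⟩ := (mem_firstSyzygies I).1 hf
  have := key f hf 1
  rw [one_smul, hf0, map_zero] at this
  exact (Submodule.Quotient.mk_eq_zero T).1 this

theorem eq_of_mem_minGens_of_le {a b : Fin n →₀ ℕ} (ha : a ∈ minGens I) (hb : b ∈ minGens I)
    (h : a ≤ b) : a = b :=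
  le_antisymm h (hb.2 ha.1 h)

/-! ### Functionals detecting the syzygies that are new in degree `m` -/

/-- The functional that adds up the coefficients in degree `m` with weights `χ`. -/
def weightedCoeff (I : Ideal (MvPolynomial (Fin n) k)) (m : Fin n →₀ ℕ) (χ : (Fin n →₀ ℕ) → k) :
    (MvPolynomial (Fin n) k ⊗[k] MvPolynomial (Fin n) k) →+ k where
  toFun f := ∑ γ ∈ (minGens_finite I).toFinset, χ γ * coeff m (coord k γ f * monomial γ 1)
  map_zero' := by simp
  map_add' f g := by simp only [map_add, add_mul, coeff_add, mul_add, Finset.sum_add_distrib]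

theorem weightedCoeff_apply (m : Fin n →₀ ℕ) (χ : (Fin n →₀ ℕ) → k)
    (f : MvPolynomial (Fin n) k ⊗[k] MvPolynomial (Fin n) k) :
    weightedCoeff I m χ f = ∑ γ ∈ (minGens_finite I).toFinset,
      χ γ * coeff m (coord k γ f * monomial γ 1) := rfl

/-- If the weights are constant on the generators with a common multiple strictly dividing `m`, the
functional kills the multiples of syzygies by polynomials without constant term. -/
theorem weightedCoeff_smul {m : Fin n →₀ ℕ} {χ : (Fin n →₀ ℕ) → k}
    (hχ : ∀ γ ∈ minGens I, ∀ γ' ∈ minGens I, γ ⊔ γ' < m → χ γ = χ γ')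
    (r : MvPolynomial (Fin n) k) {f : MvPolynomial (Fin n) k ⊗[k] MvPolynomial (Fin n) k}
    (hf : f ∈ firstSyzygies I) :
    weightedCoeff I m χ (r • f) = constantCoeff r • weightedCoeff I m χ f := by
  classical
  induction r using MvPolynomial.induction_on' with
  | add p q hp hq => rw [add_smul, map_add, hp, hq, map_add, add_smul]
  | monomial b a =>
    by_cases hb : b = 0
    · subst hb
      simp only [weightedCoeff_apply, map_smul, smul_eq_mul, mul_assoc, Finset.mul_sum]
      refine Finset.sum_congr rfl fun γ _ => ?_
      rw [coeff_monomial_mul']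
      simp
      ring
    · have hcc : constantCoeff (monomial b a) = 0 := by
        rw [constantCoeff_eq, coeff_monomial, if_neg hb]
      rw [hcc, zero_smul]
      have hterm : ∀ γ, ¬ b + γ ≤ m →
          coeff m (coord k γ (monomial b a • f) * monomial γ 1) = 0 := by
        intro γ h
        rw [map_smul, smul_eq_mul, mul_right_comm, monomial_mul, coeff_monomial_mul', if_neg h]
      have hg := (firstSyzygies I).smul_mem (monomial b a) hf
      obtain ⟨hg1, hg0⟩ := (mem_firstSyzygies I).1 hg
      rw [mulMap_eq_sum hg1] at hg0
      by_cases hex : ∃ γ₀ ∈ minGens I, b + γ₀ ≤ m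
      · obtain ⟨γ₀, hγ₀, hle⟩ := hex
        -- Only `γ` with `b + γ ≤ m` contribute. As `b ≠ 0`, the lcm of each with `γ₀` is strictly
        -- below `m`, so all weights equal `χ γ₀`; what remains is a coefficient of the image under
        -- multiplication, which is 0.
        have h1 : weightedCoeff I m χ (monomial b a • f) = χ γ₀ *
            coeff m (∑ γ ∈ (minGens_finite I).toFinset,
              coord k γ (monomial b a • f) * monomial γ 1) := by
          rw [weightedCoeff_apply, coeff_sum, Finset.mul_sum]
          refine Finset.sum_congr rfl fun γ hγ => ?_
          by_cases h : b + γ ≤ m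
          · rw [hχ γ (by simpa using hγ) γ₀ hγ₀]
            have h2 : b + (γ ⊔ γ₀) ≤ m := by
              intro i
              have := h i
              have := hle i
              simp only [Finsupp.add_apply, Finsupp.sup_apply] at *
              rcases max_choice (γ i) (γ₀ i) with h | h <;> rw [h] <;> assumption
            refine lt_of_lt_of_le ?_ h2
            exact lt_add_of_pos_left _ (pos_iff_ne_zero.2 hb)
          · rw [hterm γ h, mul_zero, mul_zero]
        rw [h1, hg0, coeff_zero, mul_zero]
      · push Not at hex
        rw [weightedCoeff_apply]
        refine Finset.sum_eq_zero fun γ hγ => ?_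
        rw [hterm γ (hex γ (by simpa using hγ)), mul_zero]

theorem weightedCoeff_tmul {m m' γ : Fin n →₀ ℕ} (χ : (Fin n →₀ ℕ) → k) (hγ : γ ∈ minGens I)
    (h : γ ≤ m') : weightedCoeff I m χ (monomial (m' - γ) (1 : k) ⊗ₜ[k] monomial γ (1 : k)) =
      if m' = m then χ γ else 0 := by
  classical
  rw [weightedCoeff_apply, Finset.sum_eq_single γ]
  · rw [coord_tmul_monomial, if_pos rfl, monomial_mul, one_mul, tsub_add_cancel_of_le h,
      coeff_monomial]
    split_ifs <;> simp
  · intro γ' _ hne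
    rw [coord_tmul_monomial, if_neg hne.symm, zero_mul, coeff_zero, mul_zero]
  · intro h
    exact absurd (by simpa using hγ) h

theorem weightedCoeff_syzElt {m m' γ γ' : Fin n →₀ ℕ} (χ : (Fin n →₀ ℕ) → k) (hγ : γ ∈ minGens I)
    (hγ' : γ' ∈ minGens I) (h : γ ≤ m') (h' : γ' ≤ m') :
    weightedCoeff I m χ (syzElt k m' γ γ') = if m' = m then χ γ - χ γ' else 0 := by
  rw [syzElt, map_sub, weightedCoeff_tmul χ hγ h, weightedCoeff_tmul χ hγ' h']
  split_ifs <;> simp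

/-! ### Generation and minimality of `Z_L` -/

/-- The index set of the generators in `Z_L`. -/
def choiceIndex (I : Ideal (MvPolynomial (Fin n) k)) : Finset (Σ _ : Fin n →₀ ℕ, ℕ) :=
  (lcmLattice_finite I).toFinset.sigma fun m => Finset.Icc 2 (numComponents (LComplex I m))

theorem mem_choiceIndex {p : Σ _ : Fin n →₀ ℕ, ℕ} : p ∈ choiceIndex I ↔
    p.1 ∈ lcmLattice I ∧ 2 ≤ p.2 ∧ p.2 ≤ numComponents (LComplex I p.1) := by
  simp [choiceIndex]

theorem card_choiceIndex : (choiceIndex I).card =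
    ∑ m ∈ (lcmLattice_finite I).toFinset, dimReducedH0 k (LComplex I m) := by
  rw [choiceIndex, Finset.card_sigma]
  refine Finset.sum_congr rfl fun m _ => ?_
  rw [dimReducedH0_eq, Nat.card_Icc]
  omega

theorem ZL_eq_range (γ : (Fin n →₀ ℕ) → ℕ → (Fin n →₀ ℕ)) :
    ZL I γ = Set.range fun p : choiceIndex I => syzElt k p.1.1 (γ p.1.1 p.1.2) (γ p.1.1 1) := by
  ext z
  simp only [ZL, Set.mem_iUnion, Set.mem_ofPred_eq, Set.mem_range, exists_prop]
  constructor
  · rintro ⟨m, hm, i, h2, hi, rfl⟩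
    exact ⟨⟨⟨m, i⟩, mem_choiceIndex.2 ⟨hm, h2, hi⟩⟩, rfl⟩
  · rintro ⟨⟨p, hp⟩, rfl⟩
    obtain ⟨hm, h2, hi⟩ := mem_choiceIndex.1 hp
    exact ⟨p.1, hm, p.2, h2, hi, rfl⟩

theorem sup_mem_lcmLattice {a b : Fin n →₀ ℕ} (ha : a ∈ minGens I) (hb : b ∈ minGens I) :
    a ⊔ b ∈ lcmLattice I :=
  ⟨{a, b}, by simp [Set.insert_subset_iff, ha, hb], by simp⟩

variable {γ : (Fin n →₀ ℕ) → ℕ → (Fin n →₀ ℕ)}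

theorem syzElt_mem_span_ZL
    (hγ : ∀ m ∈ lcmLattice I, 2 ≤ numComponents (LComplex I m) → IsLChoice I m (γ m))
    (m : Fin n →₀ ℕ) : ∀ a ∈ minGens I, ∀ b ∈ minGens I, a ≤ m → b ≤ m →
      syzElt k m a b ∈ Submodule.span (MvPolynomial (Fin n) k) (ZL I γ) := by
  classical
  induction m using WellFoundedLT.induction with
  | ind m ih =>
  have hlow : ∀ a ∈ minGens I, ∀ b ∈ minGens I, a ⊔ b < m →
      syzElt k m a b ∈ Submodule.span (MvPolynomial (Fin n) k) (ZL I γ) := by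
    intro a ha b hb hlt
    rw [← monomial_smul_syzElt hlt.le le_sup_left le_sup_right]
    exact Submodule.smul_mem _ _ (ih _ hlt a ha b hb le_sup_left le_sup_right)
  have hreach : ∀ v w : Vertex (LComplex I m), (skeleton _).Reachable v w →
      syzElt k m v.1 w.1 ∈ Submodule.span (MvPolynomial (Fin n) k) (ZL I γ) := by
    rintro v w ⟨p⟩
    induction p with
    | nil => rw [syzElt_self]; exact zero_mem _
    | @cons u v w h p ih' =>
      rw [← syzElt_add m u.1 v.1 w.1]
      obtain ⟨-, S, hS, hu, hv⟩ := h
      exact add_mem (hlow _ (singleton_mem_LComplex.1 u.2).1 _ (singleton_mem_LComplex.1 v.2).1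
        (sup_lt_of_mem_face hS hu hv)) ih'
  intro a ha b hb ham hbm
  rcases (sup_le ham hbm).lt_or_eq with hlt | heq
  · exact hlow a ha b hb hlt
  -- The monomial `m` is never a vertex of `L_{<m}`; if it is itself a generator, minimality forces
  -- `a = b`.
  by_cases hne : a = m
  · have : b = a := eq_of_mem_minGens_of_le hb ha (hne ▸ hbm)
    rw [this, syzElt_self]
    exact zero_mem _
  by_cases hne' : b = m
  · have : a = b := eq_of_mem_minGens_of_le ha hb (hne' ▸ ham)
    rw [this, syzElt_self]
    exact zero_mem _
  have hm : m ∈ lcmLattice I := heq ▸ sup_mem_lcmLattice ha hb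
  let v : Vertex (LComplex I m) := ⟨a, singleton_mem_LComplex.2 ⟨ha, ham, hne⟩⟩
  let w : Vertex (LComplex I m) := ⟨b, singleton_mem_LComplex.2 ⟨hb, hbm, hne'⟩⟩
  by_cases hcomp : 2 ≤ numComponents (LComplex I m)
  · obtain ⟨C, hC, hrep⟩ := hγ m hm hcomp
    -- A path leads from `u` to the representative of its component; the step from there to `γ m 1`
    -- is an element of `Z_L`, or zero for index 1.
    have hbase : ∀ u : Vertex (LComplex I m),
        syzElt k m u.1 (γ m 1) ∈ Submodule.span (MvPolynomial (Fin n) k) (ZL I γ) := by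
      intro u
      obtain ⟨i, hi, hiC⟩ := hC.surjOn (Set.mem_univ ((skeleton (LComplex I m)).connectedComponentMk u))
      obtain ⟨x, hx, hxC⟩ := hrep i hi
      rw [← syzElt_add m u.1 (γ m i), ← hx]
      refine add_mem (hreach u x (SimpleGraph.ConnectedComponent.exact (hiC.symm.trans hxC.symm))) ?_
      rw [hx]
      rcases eq_or_lt_of_le hi.1 with h1 | h1
      · rw [← h1, syzElt_self]
        exact zero_mem _
      · exact Submodule.subset_span (Set.mem_biUnion hm ⟨i, h1, hi.2, rfl⟩)
    have := sub_mem (hbase v) (hbase w)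
    rwa [sub_eq_add_neg, neg_syzElt, syzElt_add] at this
  · refine hreach v w (SimpleGraph.ConnectedComponent.exact ?_)
    have : Finite (Component (LComplex I m)) := Quot.finite _
    have : Subsingleton (Component (LComplex I m)) := by
      rw [← Finite.card_le_one_iff_subsingleton]
      change numComponents _ ≤ 1
      omega
    exact Subsingleton.elim _ _

theorem ZL_isMinimalGeneratingSet
    (hγ : ∀ m ∈ lcmLattice I, 2 ≤ numComponents (LComplex I m) → IsLChoice I m (γ m)) :
    IsMinimalGeneratingSet (firstSyzygies I) (ZL I γ) ∧
      (ZL I γ).encard = (bettiTwo I : ℕ∞) ∧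
      bettiTwo I = ∑ m ∈ (lcmLattice_finite I).toFinset, dimReducedH0 k (LComplex I m) := by
  classical
  have hpi : ∀ p ∈ choiceIndex I, p.1 ∈ lcmLattice I ∧ 2 ≤ numComponents (LComplex I p.1) ∧
      p.2 ∈ Set.Icc 1 (numComponents (LComplex I p.1)) ∧
      1 ∈ Set.Icc 1 (numComponents (LComplex I p.1)) := by
    intro p hp
    obtain ⟨hm, h2, hi⟩ := mem_choiceIndex.1 hp
    exact ⟨hm, h2.trans hi, ⟨by omega, hi⟩, ⟨le_rfl, by omega⟩⟩
  have hmin : ∀ m ∈ lcmLattice I, 2 ≤ numComponents (LComplex I m) →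
      ∀ i ∈ Set.Icc 1 (numComponents (LComplex I m)), γ m i ∈ minGens I ∧ γ m i ≤ m := by
    intro m hm h2 i hi
    obtain ⟨C, -, hrep⟩ := hγ m hm h2
    obtain ⟨v, hv, -⟩ := hrep i hi
    have := singleton_mem_LComplex.1 v.2
    rw [hv] at this
    exact ⟨this.1, this.2.1⟩
  -- For `p = (m, i)`, the indicator function of the component of `γ m i` in `L_{<m}`.
  let χ : (Σ _ : Fin n →₀ ℕ, ℕ) → (Fin n →₀ ℕ) → k := fun p a =>
    if ∃ v w : Vertex (LComplex I p.1), v.1 = a ∧ w.1 = γ p.1 p.2 ∧ (skeleton _).Reachable v w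
    then 1 else 0
  have hχ : ∀ p, ∀ a ∈ minGens I, ∀ b ∈ minGens I, a ⊔ b < p.1 → χ p a = χ p b := by
    have aux : ∀ p : (Σ _ : Fin n →₀ ℕ, ℕ), ∀ a ∈ minGens I, ∀ b ∈ minGens I, a ⊔ b < p.1 →
        (∃ v w : Vertex (LComplex I p.1), v.1 = a ∧ w.1 = γ p.1 p.2 ∧
          (skeleton _).Reachable v w) →
        (∃ v w : Vertex (LComplex I p.1), v.1 = b ∧ w.1 = γ p.1 p.2 ∧
          (skeleton _).Reachable v w) := by
      rintro p a ha b hb hlt ⟨v, w, hv, hw, hvw⟩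
      let u : Vertex (LComplex I p.1) := ⟨b, singleton_mem_LComplex.2
        ⟨hb, le_sup_right.trans hlt.le, (le_sup_right.trans_lt hlt).ne⟩⟩
      exact ⟨u, w, rfl, hw, (reachable_of_mem_face _
        (pair_mem_LComplex ha hb hlt) u v (by simp [u]) (by simp [hv])).trans hvw⟩
    intro p a ha b hb hlt
    have := (⟨aux p a ha b hb hlt, aux p b hb a ha (sup_comm a b ▸ hlt)⟩ : _ ↔ _)
    simp only [χ, this]
  have hχ_eval : ∀ m ∈ lcmLattice I, 2 ≤ numComponents (LComplex I m) →
      ∀ i ∈ Set.Icc 1 (numComponents (LComplex I m)),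
      ∀ j ∈ Set.Icc 1 (numComponents (LComplex I m)),
      χ ⟨m, i⟩ (γ m j) = if j = i then 1 else 0 := by
    intro m hm h2 i hi j hj
    obtain ⟨C, hC, hrep⟩ := hγ m hm h2
    obtain ⟨x, hx, hxC⟩ := hrep j hj
    obtain ⟨y, hy, hyC⟩ := hrep i hi
    have : (∃ v w : Vertex (LComplex I m), v.1 = γ m j ∧ w.1 = γ m i ∧
        (skeleton _).Reachable v w) ↔ j = i := by
      constructor
      · rintro ⟨v, w, hv, hw, hvw⟩
        obtain rfl : v = x := Subtype.ext (hv.trans hx.symm)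
        obtain rfl : w = y := Subtype.ext (hw.trans hy.symm)
        exact hC.injOn hj hi
          (hxC.symm.trans ((SimpleGraph.ConnectedComponent.sound hvw).trans hyC))
      · rintro rfl
        exact ⟨x, x, hx, hx, .rfl⟩
    simp only [χ, this]
  let z : choiceIndex I → MvPolynomial (Fin n) k ⊗[k] MvPolynomial (Fin n) k :=
    fun p => syzElt k p.1.1 (γ p.1.1 p.1.2) (γ p.1.1 1)
  let Φ : (MvPolynomial (Fin n) k ⊗[k] MvPolynomial (Fin n) k) →+ (choiceIndex I → k) :=
    AddMonoidHom.pi fun p => weightedCoeff I p.1.1 (χ p.1)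
  have hspan : Submodule.span (MvPolynomial (Fin n) k) (Set.range z) = firstSyzygies I := by
    rw [← ZL_eq_range]
    apply le_antisymm
    · rw [ZL_eq_range, Submodule.span_le]
      rintro _ ⟨⟨p, hp⟩, rfl⟩
      obtain ⟨hm, h2, hi, h1⟩ := hpi p hp
      obtain ⟨ha, ha'⟩ := hmin _ hm h2 _ hi
      obtain ⟨hb, hb'⟩ := hmin _ hm h2 _ h1
      exact syzElt_mem_firstSyzygies ha hb ha' hb'
    · exact firstSyzygies_le fun m a ha b hb ham hbm => syzElt_mem_span_ZL hγ m a ha b hb ham hbm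
  have hdual : ∀ p, Φ (z p) = Pi.single p 1 := by
    rintro ⟨⟨m, i⟩, hp⟩
    obtain ⟨hm, h2, hi, h1⟩ := hpi _ hp
    have h2i := (mem_choiceIndex.1 hp).2.1
    obtain ⟨ha, ha'⟩ := hmin _ hm h2 _ hi
    obtain ⟨hb, hb'⟩ := hmin _ hm h2 _ h1
    ext ⟨⟨m', i'⟩, hq⟩
    change weightedCoeff I m' (χ ⟨m', i'⟩) (syzElt k m (γ m i) (γ m 1)) = _
    rw [weightedCoeff_syzElt _ ha hb ha' hb', Pi.single_apply]
    by_cases hmm : m = m'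
    · subst hmm
      obtain ⟨-, -, hi', -⟩ := hpi _ hq
      have h2i' := (mem_choiceIndex.1 hq).2.1
      simp only at h2i h2i' hi hi' h1 h2 hm
      rw [hχ_eval m hm h2 i' hi' i hi, hχ_eval m hm h2 i' hi' 1 h1]
      -- Indices start at 2, so the subtracted term `γ m 1` has weight 0.
      have : (1 : ℕ) ≠ i' := by omega
      simp [this, eq_comm]
    · rw [if_neg hmm, if_neg]
      intro h
      exact hmm (congrArg (fun q => q.1.1) h).symm
  obtain ⟨h1, h2, h3⟩ := isMinimalGeneratingSet_range (constantCoeff (R := k) (σ := Fin n)) Φ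
    (fun r f hf => funext fun p => weightedCoeff_smul (hχ p.1) r hf) z hspan hdual
  rw [← ZL_eq_range] at h1 h2
  rw [bettiTwo, h3, h2]
  refine ⟨h1, rfl, ?_⟩
  rw [Fintype.card_coe, card_choiceIndex]

end Syzygies

end MonomialSyzygy

end

theorem mainTheorem1 {k : Type*} [Field k] {n : ℕ} (I : Ideal (MvPolynomial (Fin n) k))
    (hI : MonomialSyzygy.IsMonomialIdeal I)
    (γ γL : (Fin n →₀ ℕ) → ℕ → (Fin n →₀ ℕ))
    (hγ : ∀ m ∈ MonomialSyzygy.lcmLattice I,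
      2 ≤ MonomialSyzygy.numComponents (MonomialSyzygy.Gamma I m) →
        MonomialSyzygy.IsGammaChoice I m (γ m))
    (hγL : ∀ m ∈ MonomialSyzygy.lcmLattice I,
      2 ≤ MonomialSyzygy.numComponents (MonomialSyzygy.LComplex I m) →
        MonomialSyzygy.IsLChoice I m (γL m)) :
    MonomialSyzygy.IsMinimalGeneratingSet (MonomialSyzygy.firstSyzygies I)
        (MonomialSyzygy.ZGamma I γ) ∧
      MonomialSyzygy.IsMinimalGeneratingSet (MonomialSyzygy.firstSyzygies I)
        (MonomialSyzygy.ZL I γL) ∧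
      (MonomialSyzygy.ZGamma I γ).encard = (MonomialSyzygy.bettiTwo I : ℕ∞) ∧
      (MonomialSyzygy.ZL I γL).encard = (MonomialSyzygy.bettiTwo I : ℕ∞) ∧
      MonomialSyzygy.bettiTwo I = ∑ m ∈ (MonomialSyzygy.lcmLattice_finite I).toFinset,
        MonomialSyzygy.dimReducedH0 k (MonomialSyzygy.Gamma I m) ∧
      MonomialSyzygy.bettiTwo I = ∑ m ∈ (MonomialSyzygy.lcmLattice_finite I).toFinset,
        MonomialSyzygy.dimReducedH0 k (MonomialSyzygy.LComplex I m) := by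
  -- For the same representatives both sets coincide, since the component counts agree.
  have hZ : MonomialSyzygy.ZGamma I γ = MonomialSyzygy.ZL I γ := by
    simp only [MonomialSyzygy.ZGamma, MonomialSyzygy.ZL, MonomialSyzygy.numComponents_Gamma]
  obtain ⟨h1, h2, -⟩ := MonomialSyzygy.ZL_isMinimalGeneratingSet (γ := γ) fun m hm h =>
    (hγ m hm (by rwa [MonomialSyzygy.numComponents_Gamma])).isLChoice
  obtain ⟨h3, h4, h5⟩ := MonomialSyzygy.ZL_isMinimalGeneratingSet hγL
  rw [hZ]
  refine ⟨h1, h3, h2, h4, h5.trans (Finset.sum_congr rfl fun m _ => ?_), h5⟩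
  rw [MonomialSyzygy.dimReducedH0_eq, MonomialSyzygy.dimReducedH0_eq,
    MonomialSyzygy.numComponents_Gamma]
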